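/- Let $n\ge 1$ and let $k\ge 2$ be an even integer; $|\cdot|$ is the Euclidean norm of $\mathbb R^n$, and points of $\mathbb R^{n+1}$ are written $x=(x_{1,n},x_{n+1})$ with $x_{1,n}\in\mathbb R^n$, $x_{n+1}\in\mathbb R$. For $t>0$ let $(W^{0,t}_u)_{u\in[0,t]}$ be a standard $n$-dimensional Brownian bridge on $[0,t]$ from $0$ to $0$, that is, an almost surely continuous centered Gaussian process in $\mathbb R^n$ with $\mathbb E[W^{0,t,i}_sW^{0,t,j}_u]=\delta_{ij}\,(s\wedge u-\tfrac{su}{t})$. For $x,\xi\in\mathbb R^{n+1}$ set $$Y_t:=\int_0^t\Big|\frac{t-u}{t}\,x_{1,n}+\frac ut\,\xi_{1,n}+W^{0,t}_u\Big|^k\,du,\qquad U:=\xi_{n+1}-x_{n+1}-\frac{2^{k-1}}{k+1}\big(|x_{1,n}|^k+|\xi_{1,n}|^k\big)t .$$ Then there exists a constant $C=C(n,k)\ge 1$ such that for all $t>0$, all $x,\xi\in\mathbb R^{n+1}$ with $U>0$, and all $K>0$ the following hold (with the convention $0^0=1$). (i) If $|x_{1,n}|\vee|\xi_{1,n}|\ge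 Kt^{1/2}$, then $$\mathbb P[Y_t>\xi_{n+1}-x_{n+1}]\le C\Big\{\exp\Big(-C^{-1}\frac{U^2}{(|x_{1,n}|^{k-1}+|\xi_{1,n}|^{k-1})^2t^3}\Big)+\exp\Big(-C^{-1}\frac{|x_{1,n}|^2+|\xi_{1,n}|^2}{t}\Big)\sum_{i=1}^{k/2}\exp\Big(-C^{-1}\frac{U^{1/i}}{\{|x_{1,n}|^{k-2i}+|\xi_{1,n}|^{k-2i}\}^{1/i}\,t^{1+1/i}}\Big)\Big\}.$$ (ii) If $|x_{1,n}|\vee|\xi_{1,n}|\le Kt^{1/2}$, then $$\mathbb P[Y_t>\xi_{n+1}-x_{n+1}]\le C\Big\{\exp\Big(-C^{-1}\frac{U^2}{t^{k+2}}\Big)+\sum_{i=1}^{k/2}\exp\Big(-C^{-1}\frac{U^{1/i}}{t^{k/(2i)+1/i}}\Big)\Big\}.$$ -/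

import Mathlib

open MeasureTheory ProbabilityTheory

noncomputable section

/-- `W` is a standard `n`-dimensional Brownian bridge on `[0, t]` (from `0` to `0`) under `P`:
a centered Gaussian process on `[0, t]` with values in `ℝⁿ`, whose coordinates have covariance
`E[W_s^i W_u^j] = δ_ij (min s u - s u / t)`, and whose paths are almost surely continuous on
`[0, t]`. The values of `W` at times outside `[0, t]` are irrelevant. -/
structure IsBrownianBridge {Ω : Type*} [MeasurableSpace Ω] {n : ℕ} (t : ℝ)
    (W : ℝ → Ω → EuclideanSpace ℝ (Fin n)) (P : Measure Ω) : Prop where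
  gaussian : IsGaussianProcess (fun s : Set.Icc (0 : ℝ) t => W s) P
  centered : ∀ s ∈ Set.Icc (0 : ℝ) t, ∫ ω, W s ω ∂P = 0
  covariance : ∀ s ∈ Set.Icc (0 : ℝ) t, ∀ u ∈ Set.Icc (0 : ℝ) t, ∀ i j : Fin n,
    cov[fun ω => W s ω i, fun ω => W u ω j; P] = if i = j then min s u - s * u / t else 0
  continuous_paths : ∀ᵐ ω ∂P, ContinuousOn (fun s => W s ω) (Set.Icc 0 t)

/-- `Y_t = ∫₀ᵗ |((t-u)/t) a + (u/t) b + W_u|^k du`, with `a`, `b` the endpoints in `ℝⁿ` and `|·|`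
the Euclidean norm. -/
def bridgeFunctional {Ω : Type*} {n : ℕ} (k : ℕ) (t : ℝ) (a b : EuclideanSpace ℝ (Fin n))
    (W : ℝ → Ω → EuclideanSpace ℝ (Fin n)) (ω : Ω) : ℝ :=
  ∫ u in (0 : ℝ)..t, ‖((t - u) / t) • a + (u / t) • b + W u ω‖ ^ k

/-- `U_t^k(x, ξ) = ξ_{n+1} - x_{n+1} - (2^{k-1}/(k+1)) (|x_{1,n}|^k + |ξ_{1,n}|^k) t`, where a point
of `ℝ^{n+1} = ℝⁿ × ℝ` is written as the pair `(x_{1,n}, x_{n+1})`. -/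
def deviation {n : ℕ} (k : ℕ) (t : ℝ) (x ξ : EuclideanSpace ℝ (Fin n) × ℝ) : ℝ :=
  ξ.2 - x.2 - (2 : ℝ) ^ (k - 1) / ((k : ℝ) + 1) * (‖x.1‖ ^ k + ‖ξ.1‖ ^ k) * t

end

open Filter Topology

/-! Write `k = 2j`. Both bounds follow from one joint estimate, decaying in `U ^ (1/j) / t ^ (1 +
1/j) + (‖x.1‖² + ‖ξ.1‖²) / t`: this is already controlled by the summand `i = j`, where the endpoint
powers have exponent zero, and the other summands and the quadratic exponential are nonnegative and
only enlarge the right-hand side. The endpoint decay comes from slack in the centering. Convexity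
bounds the affine part of the path by `1/2 (‖x.1‖^k + ‖ξ.1‖^k) t`, while `deviation` subtracts at
least `2/3` of that sum. Giving the affine part weight `7/6` costs `7/12`, so on the event the
bridge term exceeds `U + 1/12 (‖x.1‖^k + ‖ξ.1‖^k) t` (`bridgeFunctional_le`, `level_pow_le`). The
tail of that term, `measure_integral_normSq_pow_le`, is Markov's inequality for `∫ exp (‖W u‖² / (n
t)) du`, whose integrand has mean at most `√2` at each time. -/

/-- A weighted form of the convexity of `s ↦ s ^ k`, with weight close to one on the first term. -/
lemma exists_add_pow_le_mul_pow_add (k : ℕ) (hk : 0 < k) :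
    ∃ D : ℝ, 1 ≤ D ∧ ∀ x y : ℝ, 0 ≤ x → 0 ≤ y →
      (x + y) ^ k ≤ 7 / 6 * x ^ k + D * y ^ k := by
  have hk' : (0 : ℝ) < k := by exact_mod_cast hk
  -- With this `δ`, `(1 + δ)^k ≤ e^(1/7) ≤ 7/6`; the last step is `e^(-1/7) ≥ 6/7`.
  set δ : ℝ := 1 / (7 * k) with hδ
  have hδ0 : 0 < δ := by positivity
  have hbase : (1 + δ) ^ k ≤ 7 / 6 := by
    calc (1 + δ) ^ k ≤ Real.exp δ ^ k := by
          gcongr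
          linarith [Real.add_one_le_exp δ]
      _ = Real.exp (1 / 7) := by
          rw [← Real.exp_nat_mul, hδ]
          congr 1
          field_simp
      _ ≤ 7 / 6 := by
          have h := Real.add_one_le_exp (-(1 / 7 : ℝ))
          have h2 : Real.exp (1 / 7 : ℝ) * Real.exp (-(1 / 7)) = 1 := by
            rw [← Real.exp_add]; simp
          nlinarith [Real.exp_pos (1 / 7 : ℝ)]
  refine ⟨(1 / δ + 1) ^ k, one_le_pow₀ (by linarith [one_div_pos.2 hδ0]), fun x y hx hy => ?_⟩
  have hyk : 0 ≤ (1 / δ + 1) ^ k * y ^ k := by positivity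
  have hxk : 0 ≤ 7 / 6 * x ^ k := by positivity
  rcases le_total y (δ * x) with h | h
  · calc (x + y) ^ k ≤ ((1 + δ) * x) ^ k := by gcongr; linarith
      _ = (1 + δ) ^ k * x ^ k := mul_pow _ _ _
      _ ≤ 7 / 6 * x ^ k := by gcongr
      _ ≤ _ := by linarith
  · have hx' : x ≤ 1 / δ * y := by
      rw [one_div, ← div_eq_inv_mul, le_div_iff₀ hδ0]; linarith
    calc (x + y) ^ k ≤ ((1 / δ + 1) * y) ^ k := by gcongr; linarith
      _ = (1 / δ + 1) ^ k * y ^ k := mul_pow _ _ _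
      _ ≤ _ := by linarith

/-! ### Markov's inequality for time integrals -/

/-- Left Riemann sums of a continuous function converge to its integral. -/
lemma tendsto_leftRiemannSum {t : ℝ} (ht : 0 < t) {f : ℝ → ℝ}
    (hf : ContinuousOn f (Set.Icc 0 t)) :
    Tendsto (fun m : ℕ => ∑ i ∈ Finset.range (m + 1), t / (m + 1) * f (i * (t / (m + 1)))) atTop
      (𝓝 (∫ u in (0 : ℝ)..t, f u)) := by
  rw [Metric.tendsto_atTop]
  intro ε hε
  obtain ⟨δ, hδ, hfδ⟩ := Metric.uniformContinuousOn_iff_le.1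
    (isCompact_Icc.uniformContinuousOn_of_continuous hf) (ε / (2 * t)) (by positivity)
  obtain ⟨N, hN⟩ := exists_nat_gt (t / δ)
  refine ⟨N, fun m hm => ?_⟩
  have hm1 : (0 : ℝ) < (m : ℝ) + 1 := by positivity
  set h : ℝ := t / (m + 1) with hh
  have hh0 : 0 < h := by positivity
  have hmh : ((m : ℝ) + 1) * h = t := by rw [hh]; field_simp
  have hhδ : h ≤ δ := by
    rw [hh, div_le_iff₀ hm1]
    rw [div_lt_iff₀ hδ] at hN
    have : (N : ℝ) ≤ m := by exact_mod_cast hm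
    nlinarith
  have hmem : ∀ i : ℕ, i ≤ m + 1 → (i : ℝ) * h ∈ Set.Icc 0 t := fun i hi => by
    have : (i : ℝ) ≤ m + 1 := by exact_mod_cast hi
    exact ⟨by positivity, by nlinarith⟩
  have hsub : ∀ i : ℕ, i < m + 1 →
      Set.uIcc ((i : ℝ) * h) (((i + 1 : ℕ) : ℝ) * h) ⊆ Set.Icc 0 t := fun i hi =>
    (convex_Icc (0 : ℝ) t).ordConnected.uIcc_subset (hmem i hi.le) (hmem (i + 1) hi)
  have hint : ∀ i < m + 1,
      IntervalIntegrable f volume ((i : ℝ) * h) (((i + 1 : ℕ) : ℝ) * h) :=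
    fun i hi => (hf.mono (hsub i hi)).intervalIntegrable
  have hsum := intervalIntegral.sum_integral_adjacent_intervals
    (a := fun i : ℕ => (i : ℝ) * h) hint
  have hend : (((m + 1 : ℕ) : ℝ)) * h = t := by push_cast; exact hmh
  simp only [Nat.cast_zero, zero_mul, hend] at hsum
  rw [← hsum, dist_comm, Real.dist_eq, ← Finset.sum_sub_distrib]
  have hpiece : ∀ i ∈ Finset.range (m + 1),
      |(∫ u in ((i : ℝ) * h)..(((i + 1 : ℕ) : ℝ) * h), f u) - h * f (i * h)|
        ≤ ε / (2 * t) * h := by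
    intro i hi
    have hi' := Finset.mem_range.1 hi
    have hlen : ((i + 1 : ℕ) : ℝ) * h - i * h = h := by push_cast; ring
    have hconst : h * f (i * h) = ∫ _ in ((i : ℝ) * h)..(((i + 1 : ℕ) : ℝ) * h), f (i * h) := by
      rw [intervalIntegral.integral_const, hlen, smul_eq_mul]
    rw [hconst, ← intervalIntegral.integral_sub (hint i hi') intervalIntegrable_const]
    have hb := intervalIntegral.norm_integral_le_of_norm_le_const
      (f := fun u => f u - f (i * h)) (C := ε / (2 * t)) (a := (i : ℝ) * h)
      (b := ((i + 1 : ℕ) : ℝ) * h) ?_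
    · rwa [hlen, abs_of_pos hh0] at hb
    · intro u hu
      rw [← dist_eq_norm]
      refine hfδ u (hsub i hi' (Set.uIoc_subset_uIcc hu)) _ (hmem i hi'.le) ?_
      rw [Set.uIoc_of_le (by push_cast; nlinarith)] at hu
      rw [Real.dist_eq, abs_of_nonneg (by linarith [hu.1])]
      have := hu.2
      push_cast at this
      linarith
  calc _ ≤ ∑ i ∈ Finset.range (m + 1), ε / (2 * t) * h :=
        (Finset.abs_sum_le_sum_abs _ _).trans (Finset.sum_le_sum hpiece)
    _ = ε / (2 * t) * (((m : ℝ) + 1) * h) := by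
        rw [Finset.sum_const, Finset.card_range, nsmul_eq_mul]; push_cast; ring
    _ = ε / 2 := by rw [hmh]; field_simp
    _ < ε := by linarith

/-- Markov's inequality for the time integral of a nonnegative process with almost surely
continuous paths. Only the measurability of the marginals is needed. -/
lemma measure_le_intervalIntegral_le {Ω : Type*} [MeasurableSpace Ω] {P : Measure Ω} {t : ℝ}
    (ht : 0 < t) {Z : ℝ → Ω → ℝ} (hZ0 : ∀ u ω, 0 ≤ Z u ω)
    (hZm : ∀ u ∈ Set.Icc 0 t, AEMeasurable (Z u) P)
    (hZc : ∀ᵐ ω ∂P, ContinuousOn (fun u => Z u ω) (Set.Icc 0 t)) {B : ℝ}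
    (hZB : ∀ u ∈ Set.Icc 0 t, ∫⁻ ω, ENNReal.ofReal (Z u ω) ∂P ≤ ENNReal.ofReal B)
    {θ : ℝ} (hθ : 0 < θ) :
    P {ω | θ ≤ ∫ u in (0 : ℝ)..t, Z u ω} ≤ ENNReal.ofReal (t * B / θ) := by
  -- Riemann sums and Fatou's lemma replace Tonelli, which would need joint measurability of `Z`.
  set R : ℕ → Ω → ENNReal := fun m ω =>
    ∑ i ∈ Finset.range (m + 1),
      ENNReal.ofReal (t / (m + 1)) * ENNReal.ofReal (Z (i * (t / (m + 1))) ω) with hR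
  have hmem : ∀ m : ℕ, ∀ i ∈ Finset.range (m + 1), (i : ℝ) * (t / (m + 1)) ∈ Set.Icc 0 t := by
    intro m i hi
    have : (i : ℝ) ≤ m + 1 := by exact_mod_cast (Finset.mem_range.1 hi).le
    refine ⟨by positivity, ?_⟩
    rw [mul_div_assoc', div_le_iff₀ (by positivity)]
    nlinarith
  have hRm : ∀ m, AEMeasurable (R m) P := fun m =>
    Finset.aemeasurable_fun_sum _ fun i hi => ((hZm _ (hmem m i hi)).ennreal_ofReal).const_mul _
  have hRint : ∀ m, ∫⁻ ω, R m ω ∂P ≤ ENNReal.ofReal (t * B) := by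
    intro m
    have hm1 : (0 : ℝ) < (m : ℝ) + 1 := by positivity
    rw [hR, lintegral_finsetSum' _ fun i hi =>
      ((hZm _ (hmem m i hi)).ennreal_ofReal).const_mul _]
    calc _ ≤ ∑ i ∈ Finset.range (m + 1), ENNReal.ofReal (t / (m + 1)) * ENNReal.ofReal B := by
          refine Finset.sum_le_sum fun i hi => ?_
          rw [lintegral_const_mul' _ _ ENNReal.ofReal_ne_top]
          gcongr
          exact hZB _ (hmem m i hi)
      _ = ENNReal.ofReal (t * B) := by
          rw [Finset.sum_const, Finset.card_range, ← ENNReal.ofReal_mul (by positivity),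
            ← ENNReal.ofReal_nsmul, nsmul_eq_mul]
          congr 1
          push_cast
          field_simp
  have hlim : ∀ᵐ ω ∂P,
      ENNReal.ofReal (∫ u in (0 : ℝ)..t, Z u ω) = liminf (fun m => R m ω) atTop := by
    filter_upwards [hZc] with ω hω
    refine (Tendsto.liminf_eq ?_).symm
    refine ((ENNReal.continuous_ofReal.tendsto _).comp (tendsto_leftRiemannSum ht hω)).congr
      fun m => ?_
    simp only [Function.comp, hR]
    rw [ENNReal.ofReal_sum_of_nonneg fun i _ => mul_nonneg (by positivity) (hZ0 _ _)]
    exact Finset.sum_congr rfl fun i _ => ENNReal.ofReal_mul (by positivity)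
  have hint : ∫⁻ ω, liminf (fun m => R m ω) atTop ∂P ≤ ENNReal.ofReal (t * B) :=
    (lintegral_liminf_le' hRm).trans (liminf_le_of_le (by isBoundedDefault) fun b hb => by
      obtain ⟨m, hm⟩ := hb.exists
      exact hm.trans (hRint m))
  have hlimm : AEMeasurable (fun ω => liminf (fun m => R m ω) atTop) P := by
    refine ⟨fun ω => liminf (fun m => (hRm m).mk _ ω) atTop,
      Measurable.liminf fun m => (hRm m).measurable_mk, ?_⟩
    filter_upwards [ae_all_iff.2 fun m => (hRm m).ae_eq_mk] with ω hω
    simp only [hω]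
  have hθ' : ENNReal.ofReal θ ≠ 0 := by simpa using hθ
  calc P {ω | θ ≤ ∫ u in (0 : ℝ)..t, Z u ω}
      ≤ P {ω | ENNReal.ofReal θ ≤ liminf (fun m => R m ω) atTop} := by
        refine measure_mono_ae ?_
        filter_upwards [hlim] with ω hω h
        change ENNReal.ofReal θ ≤ _
        rw [← hω]
        exact ENNReal.ofReal_le_ofReal h
    _ ≤ (∫⁻ ω, liminf (fun m => R m ω) atTop ∂P) / ENNReal.ofReal θ :=
        meas_ge_le_lintegral_div hlimm hθ' ENNReal.ofReal_ne_top
    _ ≤ ENNReal.ofReal (t * B) / ENNReal.ofReal θ := by gcongr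
    _ = ENNReal.ofReal (t * B / θ) := (ENNReal.ofReal_div_of_pos hθ).symm

/-! ### Exponential moments and tails of the bridge -/

/-- Exponential square moments of a centered real Gaussian. -/
lemma lintegral_exp_mul_sq_gaussianReal_le (v : NNReal) {a : ℝ} (ha : 4 * a * v ≤ 1) :
    ∫⁻ x, ENNReal.ofReal (Real.exp (a * x ^ 2)) ∂gaussianReal 0 v ≤ ENNReal.ofReal √2 := by
  rcases eq_or_ne v 0 with rfl | hv
  · rw [gaussianReal_zero_var, lintegral_dirac]
    refine ENNReal.ofReal_le_ofReal ?_
    simp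
  have hv0 : (0 : ℝ) < v := by positivity
  rw [gaussianReal_of_var_ne_zero _ hv,
    lintegral_withDensity_eq_lintegral_mul _ (measurable_gaussianPDF 0 v) (by fun_prop)]
  -- Since `a ≤ 1/(4v)`, the tilted density is at most `√2` times the Gaussian density of variance
  -- `2v`.
  have hpt : ∀ x, (gaussianPDF 0 v * fun x => ENNReal.ofReal (Real.exp (a * x ^ 2))) x
      ≤ ENNReal.ofReal √2 * gaussianPDF 0 (2 * v) x := by
    intro x
    simp only [Pi.mul_apply, gaussianPDF, gaussianPDFReal]
    rw [← ENNReal.ofReal_mul (by positivity), ← ENNReal.ofReal_mul (by positivity)]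
    refine ENNReal.ofReal_le_ofReal ?_
    have hs : √(2 * Real.pi * ((2 * v : NNReal) : ℝ)) = √2 * √(2 * Real.pi * v) := by
      rw [← Real.sqrt_mul (by norm_num)]
      congr 1
      push_cast
      ring
    rw [hs, mul_inv, mul_assoc, ← Real.exp_add, ← mul_assoc, ← mul_assoc,
      mul_inv_cancel₀ (by positivity), one_mul]
    gcongr
    have h1 : a * x ^ 2 ≤ x ^ 2 / (4 * v) := by
      rw [le_div_iff₀ (by positivity)]
      nlinarith [sq_nonneg x]
    have h2 : -(x - 0) ^ 2 / (2 * (v : ℝ)) + x ^ 2 / (4 * v)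
        = -(x - 0) ^ 2 / (2 * ((2 * v : NNReal) : ℝ)) := by
      push_cast
      field_simp
      ring
    linarith
  calc _ ≤ ∫⁻ x, ENNReal.ofReal √2 * gaussianPDF 0 (2 * v) x := lintegral_mono hpt
    _ = ENNReal.ofReal √2 := by
      rw [lintegral_const_mul' _ _ ENNReal.ofReal_ne_top,
        lintegral_gaussianPDF_eq_one _ (by positivity), mul_one]

namespace IsBrownianBridge

variable {Ω : Type*} [MeasurableSpace Ω] {P : Measure Ω} {n : ℕ} {t : ℝ}
  {W : ℝ → Ω → EuclideanSpace ℝ (Fin n)}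

lemma map_coord_eq_gaussianReal (hW : IsBrownianBridge t W P) {u : ℝ} (hu : u ∈ Set.Icc 0 t)
    (i : Fin n) :
    P.map (fun ω => W u ω i) = gaussianReal 0 (u - u * u / t).toNNReal := by
  have hG : HasGaussianLaw (W u) P := hW.gaussian.hasGaussianLaw_eval ⟨u, hu⟩
  have hGi : HasGaussianLaw (fun ω => W u ω i) P := hG.map_fun (EuclideanSpace.proj i)
  rw [hGi.map_eq_gaussianReal]
  congr 2
  · have h := (EuclideanSpace.proj (𝕜 := ℝ) i).integral_comp_comm hG.integrable
    rw [hW.centered u hu, map_zero] at h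
    exact h
  · rw [← covariance_self hGi.aemeasurable, hW.covariance u hu u hu i i]
    simp

/-- Each coordinate has variance `u(t-u)/t ≤ t/4`, which allows the rate `1/t`. Jensen's inequality
over the `n` coordinates gives the rate `1/n` and avoids any appeal to their independence. -/
lemma lintegral_exp_normSq_le (hW : IsBrownianBridge t W P) (hn : 1 ≤ n) (ht : 0 < t) {u : ℝ}
    (hu : u ∈ Set.Icc 0 t) :
    ∫⁻ ω, ENNReal.ofReal (Real.exp (1 / n * (‖W u ω‖ ^ 2 / t))) ∂P ≤ ENNReal.ofReal √2 := by
  have hn0 : (0 : ℝ) < n := by exact_mod_cast hn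
  have hm : AEMeasurable (W u) P := hW.gaussian.aemeasurable ⟨u, hu⟩
  have hmi : ∀ i : Fin n, AEMeasurable (fun ω => W u ω i) P := fun i =>
    (EuclideanSpace.proj (𝕜 := ℝ) i).continuous.measurable.comp_aemeasurable hm
  have hcoord : ∀ i : Fin n,
      ∫⁻ ω, ENNReal.ofReal (Real.exp (1 / t * W u ω i ^ 2)) ∂P ≤ ENNReal.ofReal √2 := by
    intro i
    have hmap := lintegral_map' (μ := P) (g := fun ω => W u ω i)
      (f := fun x : ℝ => ENNReal.ofReal (Real.exp (1 / t * x ^ 2))) (by fun_prop) (hmi i)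
    rw [← hmap, hW.map_coord_eq_gaussianReal hu i]
    refine lintegral_exp_mul_sq_gaussianReal_le _ ?_
    have hvar : u - u * u / t = u * (t - u) / t := by field_simp
    rw [hvar, Real.coe_toNNReal _ (div_nonneg (mul_nonneg hu.1 (by linarith [hu.2])) ht.le)]
    have : 4 * (1 / t) * (u * (t - u) / t) = 4 * (u * (t - u)) / t ^ 2 := by field_simp
    rw [this, div_le_one (by positivity)]
    nlinarith [sq_nonneg (t - 2 * u)]
  have hjensen : ∀ ω, ENNReal.ofReal (Real.exp (1 / n * (‖W u ω‖ ^ 2 / t)))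
      ≤ ∑ i : Fin n, ENNReal.ofReal (1 / n) *
          ENNReal.ofReal (Real.exp (1 / t * W u ω i ^ 2)) := by
    intro ω
    have h := convexOn_exp.map_sum_le (t := Finset.univ) (w := fun _ : Fin n => (1 / n : ℝ))
      (p := fun i => 1 / t * W u ω i ^ 2) (fun _ _ => by positivity)
      (by simp [hn0.ne']) (fun _ _ => Set.mem_univ _)
    simp only [smul_eq_mul] at h
    have harg : 1 / n * (‖W u ω‖ ^ 2 / t) = ∑ i : Fin n, 1 / n * (1 / t * W u ω i ^ 2) := by
      rw [EuclideanSpace.real_norm_sq_eq, ← Finset.mul_sum, ← Finset.mul_sum]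
      ring
    rw [harg]
    refine (ENNReal.ofReal_le_ofReal h).trans_eq ?_
    rw [ENNReal.ofReal_sum_of_nonneg fun _ _ => by positivity]
    exact Finset.sum_congr rfl fun i _ => ENNReal.ofReal_mul (by positivity)
  calc _ ≤ ∫⁻ ω, ∑ i : Fin n, ENNReal.ofReal (1 / n) *
          ENNReal.ofReal (Real.exp (1 / t * W u ω i ^ 2)) ∂P := lintegral_mono hjensen
    _ ≤ ∑ i : Fin n, ENNReal.ofReal (1 / n) * ENNReal.ofReal √2 := by
        rw [lintegral_finsetSum' _ fun i _ =>
          ((((hmi i).pow_const 2).const_mul _).exp.ennreal_ofReal).const_mul _]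
        refine Finset.sum_le_sum fun i _ => ?_
        rw [lintegral_const_mul' _ _ ENNReal.ofReal_ne_top]
        gcongr
        exact hcoord i
    _ = ENNReal.ofReal √2 := by
        rw [Finset.sum_const, Finset.card_univ, Fintype.card_fin,
          ← ENNReal.ofReal_mul (by positivity), ← ENNReal.ofReal_nsmul, nsmul_eq_mul]
        congr 1
        field_simp

/-- Tail bound for the integral of an even power of the norm of a Brownian bridge. -/
lemma measure_integral_normSq_pow_le [IsProbabilityMeasure P] (hW : IsBrownianBridge t W P)
    (hn : 1 ≤ n) (ht : 0 < t) (j : ℕ) {L : ℝ} (hL : 0 ≤ L) :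
    P.real {ω | 2 * t * L ^ j < ∫ u in (0 : ℝ)..t, (‖W u ω‖ ^ 2 / t) ^ j}
      ≤ (√2 * (j.factorial * (2 * n) ^ j) + Real.exp (1 / (2 * n))) *
        Real.exp (-(L / (2 * n))) := by
  have hn0 : (0 : ℝ) < n := by exact_mod_cast hn
  set D : ℝ := j.factorial * (2 * n) ^ j with hD
  have hD0 : 0 < D := by positivity
  -- For `L ≤ 1` the bound is trivial, thanks to the summand `exp (1/(2n))`.
  rcases le_total L 1 with hL1 | hL1
  · calc _ ≤ (1 : ℝ) := measureReal_le_one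
      _ ≤ Real.exp (1 / (2 * n)) * Real.exp (-(L / (2 * n))) := by
          rw [← Real.exp_add, Real.one_le_exp_iff, ← sub_eq_add_neg, ← sub_div]
          exact div_nonneg (by linarith) (by positivity)
      _ ≤ _ := by
          gcongr
          linarith [show 0 ≤ √2 * D by positivity]
  -- For `q ≥ L`, split `e^(q/n)` into two equal factors: one dominates `q^j / D`, the other is at
  -- least `e^(L/(2n))`.
  have hpt : ∀ q : ℝ, 0 ≤ q →
      q ^ j ≤ L ^ j + D * Real.exp (-(L / (2 * n))) * Real.exp (1 / n * q) := by
    intro q hq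
    rcases le_total q L with h | h
    · have : q ^ j ≤ L ^ j := by gcongr
      have : 0 ≤ D * Real.exp (-(L / (2 * n))) * Real.exp (1 / n * q) := by positivity
      linarith
    · have h1 := Real.pow_div_factorial_le_exp (x := q / (2 * n)) (by positivity) j
      have h2 : q ^ j ≤ D * Real.exp (q / (2 * n)) := by
        rw [div_pow, div_div, div_le_iff₀ (by positivity)] at h1
        calc q ^ j ≤ _ := h1
          _ = _ := by rw [hD]; ring
      have h3 : Real.exp (q / (2 * n)) ≤ Real.exp (-(L / (2 * n))) * Real.exp (1 / n * q) := by
        rw [← Real.exp_add, Real.exp_le_exp]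
        have : 1 / n * q = q / (2 * n) + q / (2 * n) := by field_simp; norm_num
        have : L / (2 * n) ≤ q / (2 * n) := by gcongr
        linarith
      calc q ^ j ≤ D * (Real.exp (-(L / (2 * n))) * Real.exp (1 / n * q)) := h2.trans (by gcongr)
        _ ≤ _ := by rw [← mul_assoc]; linarith [pow_nonneg hL j]
  -- Integrating `hpt` uses up `t L^j` of the level `2 t L^j`; the remaining `t L^j` is at least `t`
  -- because `L ≥ 1`.
  set θ : ℝ := t / (D * Real.exp (-(L / (2 * n)))) with hθ
  have hθ0 : 0 < θ := by positivity
  have hsub : P {ω | 2 * t * L ^ j < ∫ u in (0 : ℝ)..t, (‖W u ω‖ ^ 2 / t) ^ j}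
      ≤ P {ω | θ ≤ ∫ u in (0 : ℝ)..t, Real.exp (1 / n * (‖W u ω‖ ^ 2 / t))} := by
    refine measure_mono_ae ?_
    filter_upwards [hW.continuous_paths] with ω hω h
    change θ ≤ _
    change 2 * t * L ^ j < _ at h
    have hω' : ContinuousOn (fun u => W u ω) (Set.uIcc 0 t) := by rwa [Set.uIcc_of_le ht.le]
    have hi1 : IntervalIntegrable (fun u => (‖W u ω‖ ^ 2 / t) ^ j) volume 0 t :=
      ContinuousOn.intervalIntegrable (by fun_prop)
    have hi2 : IntervalIntegrable (fun u => Real.exp (1 / n * (‖W u ω‖ ^ 2 / t))) volume 0 t :=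
      ContinuousOn.intervalIntegrable (by fun_prop)
    have hmono : ∫ u in (0 : ℝ)..t, (‖W u ω‖ ^ 2 / t) ^ j ≤ ∫ u in (0 : ℝ)..t,
        (L ^ j + D * Real.exp (-(L / (2 * n))) * Real.exp (1 / n * (‖W u ω‖ ^ 2 / t))) :=
      intervalIntegral.integral_mono_on ht.le hi1 (intervalIntegrable_const.add (hi2.const_mul _))
        fun u _ => hpt _ (by positivity)
    rw [intervalIntegral.integral_add intervalIntegrable_const (hi2.const_mul _),
      intervalIntegral.integral_const, intervalIntegral.integral_const_mul, smul_eq_mul,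
      sub_zero] at hmono
    rw [hθ, div_le_iff₀' (by positivity)]
    have : t ≤ t * L ^ j := le_mul_of_one_le_right ht.le (one_le_pow₀ hL1)
    linarith
  have hmarkov := measure_le_intervalIntegral_le (P := P) ht
    (Z := fun u ω => Real.exp (1 / n * (‖W u ω‖ ^ 2 / t)))
    (fun _ _ => (Real.exp_pos _).le)
    (fun u hu => by
      have hm : AEMeasurable (W u) P := hW.gaussian.aemeasurable ⟨u, hu⟩
      fun_prop)
    (by filter_upwards [hW.continuous_paths] with ω hω; fun_prop)
    (fun u hu => hW.lintegral_exp_normSq_le hn ht hu) hθ0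
  have hval : t * √2 / θ = √2 * D * Real.exp (-(L / (2 * n))) := by
    rw [hθ]; field_simp
  rw [hval] at hmarkov
  calc _ ≤ √2 * D * Real.exp (-(L / (2 * n))) :=
        ENNReal.toReal_le_of_le_ofReal (by positivity) (hsub.trans hmarkov)
    _ ≤ _ := by
        gcongr
        linarith [Real.exp_pos (1 / (2 * n : ℝ))]

end IsBrownianBridge

/-! ### Pathwise domination and choice of level -/

/-- The constant in `deviation` exceeds the one obtained from convexity of `s ↦ s ^ k`. -/
lemma two_thirds_le_two_pow_div {k : ℕ} (hk : 2 ≤ k) :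
    (2 / 3 : ℝ) ≤ 2 ^ (k - 1) / ((k : ℝ) + 1) := by
  rw [le_div_iff₀ (by positivity)]
  -- Equality holds at `k = 2`; afterwards the left side grows by `2/3` while the right side
  -- doubles.
  induction k, hk using Nat.le_induction with
  | base => norm_num
  | succ m hm ih =>
    have h2 : (2 : ℝ) ≤ m := by exact_mod_cast hm
    obtain ⟨p, rfl⟩ : ∃ p, m = p + 1 := ⟨m - 1, by omega⟩
    simp only [Nat.add_sub_cancel] at ih ⊢
    rw [pow_succ]
    push_cast at ih h2 ⊢
    linarith

lemma norm_affineCombination_pow_le {E : Type*} [SeminormedAddCommGroup E] [NormedSpace ℝ E]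
    {t u : ℝ} (ht : 0 < t) (hu : u ∈ Set.Icc 0 t) (a b : E) (k : ℕ) :
    ‖((t - u) / t) • a + (u / t) • b‖ ^ k ≤ (t - u) / t * ‖a‖ ^ k + u / t * ‖b‖ ^ k := by
  have h1 : 0 ≤ (t - u) / t := div_nonneg (by linarith [hu.2]) ht.le
  have h2 : 0 ≤ u / t := div_nonneg hu.1 ht.le
  have hconv := (convexOn_pow (𝕜 := ℝ) k).2 (norm_nonneg a) (norm_nonneg b) h1 h2
    (by field_simp; ring)
  simp only [smul_eq_mul] at hconv
  refine le_trans ?_ hconv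
  gcongr
  refine (norm_add_le _ _).trans_eq ?_
  rw [norm_smul, norm_smul, Real.norm_of_nonneg h1, Real.norm_of_nonneg h2]

/-- Pathwise domination of the bridge functional by the endpoints and the bridge alone. -/
lemma bridgeFunctional_le {Ω : Type*} {n j : ℕ} {t D : ℝ} (ht : 0 < t)
    (hD : ∀ x y : ℝ, 0 ≤ x → 0 ≤ y → (x + y) ^ (2 * j) ≤ 7 / 6 * x ^ (2 * j) + D * y ^ (2 * j))
    (a b : EuclideanSpace ℝ (Fin n)) {W : ℝ → Ω → EuclideanSpace ℝ (Fin n)} {ω : Ω}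
    (hω : ContinuousOn (fun s => W s ω) (Set.Icc 0 t)) :
    bridgeFunctional (2 * j) t a b W ω ≤ 7 / 12 * (‖a‖ ^ (2 * j) + ‖b‖ ^ (2 * j)) * t
      + D * t ^ j * ∫ u in (0 : ℝ)..t, (‖W u ω‖ ^ 2 / t) ^ j := by
  have hω' : ContinuousOn (fun u => W u ω) (Set.uIcc 0 t) := by rwa [Set.uIcc_of_le ht.le]
  have hi1 : IntervalIntegrable
      (fun u => ‖((t - u) / t) • a + (u / t) • b + W u ω‖ ^ (2 * j)) volume 0 t :=
    ContinuousOn.intervalIntegrable (by fun_prop)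
  have hi2 : IntervalIntegrable (fun u => (‖W u ω‖ ^ 2 / t) ^ j) volume 0 t :=
    ContinuousOn.intervalIntegrable (by fun_prop)
  have hi3 : IntervalIntegrable
      (fun u => 7 / 6 * ((t - u) / t * ‖a‖ ^ (2 * j) + u / t * ‖b‖ ^ (2 * j))) volume 0 t :=
    Continuous.intervalIntegrable (by fun_prop) _ _
  have hmono : bridgeFunctional (2 * j) t a b W ω ≤ ∫ u in (0 : ℝ)..t,
      (7 / 6 * ((t - u) / t * ‖a‖ ^ (2 * j) + u / t * ‖b‖ ^ (2 * j))
        + D * t ^ j * (‖W u ω‖ ^ 2 / t) ^ j) := by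
    refine intervalIntegral.integral_mono_on ht.le hi1 (hi3.add (hi2.const_mul _)) fun u hu => ?_
    have hpow : t ^ j * (‖W u ω‖ ^ 2 / t) ^ j = ‖W u ω‖ ^ (2 * j) := by
      rw [← mul_pow, mul_div_cancel₀ _ ht.ne', pow_mul]
    rw [mul_assoc, hpow]
    calc _ ≤ (‖((t - u) / t) • a + (u / t) • b‖ + ‖W u ω‖) ^ (2 * j) := by
          gcongr
          exact norm_add_le _ _
      _ ≤ _ := hD _ _ (norm_nonneg _) (norm_nonneg _)
      _ ≤ _ := by
          gcongr
          exact norm_affineCombination_pow_le ht hu a b _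
  have hlin : ∫ u in (0 : ℝ)..t, (7 / 6 * ((t - u) / t * ‖a‖ ^ (2 * j) + u / t * ‖b‖ ^ (2 * j)))
      = 7 / 12 * (‖a‖ ^ (2 * j) + ‖b‖ ^ (2 * j)) * t := by
    have hfun : (fun u : ℝ => 7 / 6 * ((t - u) / t * ‖a‖ ^ (2 * j) + u / t * ‖b‖ ^ (2 * j)))
        = fun u => 7 / 6 * ‖a‖ ^ (2 * j) + 7 / 6 / t * (‖b‖ ^ (2 * j) - ‖a‖ ^ (2 * j)) * u := by
      funext u
      field_simp
      ring
    rw [hfun, intervalIntegral.integral_add intervalIntegrable_const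
      (Continuous.intervalIntegrable (by fun_prop) _ _), intervalIntegral.integral_const,
      intervalIntegral.integral_const_mul, integral_id, smul_eq_mul]
    field_simp
    ring
  rwa [intervalIntegral.integral_add hi3 (hi2.const_mul _), hlin,
    intervalIntegral.integral_const_mul] at hmono

/-- The choice of level at which the tail bound for the bridge is applied. -/
lemma level_pow_le {j : ℕ} (hj : 1 ≤ j) {t U D x y : ℝ} (ht : 0 < t) (hU : 0 ≤ U) (hD : 1 ≤ D) :
    D * t ^ j * (2 * t * (1 / (96 * D) *
        (U ^ (1 / (j : ℝ)) / t ^ (1 + 1 / (j : ℝ)) + (x ^ 2 + y ^ 2) / t)) ^ j)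
      ≤ U + 1 / 12 * (x ^ (2 * j) + y ^ (2 * j)) * t := by
  have hj0 : j ≠ 0 := by omega
  have hjR : (j : ℝ) ≠ 0 := by exact_mod_cast hj0
  have hD0 : 0 < D := by linarith
  have hα : (U ^ (1 / (j : ℝ)) / t ^ (1 + 1 / (j : ℝ))) ^ j = U / t ^ (j + 1) := by
    rw [div_pow, ← Real.rpow_natCast (U ^ _), ← Real.rpow_mul hU, one_div_mul_cancel hjR,
      Real.rpow_one, ← Real.rpow_natCast (t ^ _), ← Real.rpow_mul ht.le, add_mul,
      one_div_mul_cancel hjR, one_mul, ← Real.rpow_natCast t]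
    push_cast
    rfl
  have hβ : ((x ^ 2 + y ^ 2) / t) ^ j ≤ 2 ^ (j - 1) * (x ^ (2 * j) + y ^ (2 * j)) / t ^ j := by
    rw [div_pow, pow_mul, pow_mul]
    gcongr
    exact add_pow_le (sq_nonneg _) (sq_nonneg _) j
  have hS : 0 ≤ x ^ (2 * j) + y ^ (2 * j) := by rw [pow_mul, pow_mul]; positivity
  have hpow2 : (2 : ℝ) ^ (j - 1) ≤ 2 ^ j := pow_le_pow_right₀ (by norm_num) (by omega)
  have hsum : (U ^ (1 / (j : ℝ)) / t ^ (1 + 1 / (j : ℝ)) + (x ^ 2 + y ^ 2) / t) ^ j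
      ≤ 4 ^ j * (U / t ^ (j + 1) + (x ^ (2 * j) + y ^ (2 * j)) / t ^ j) := by
    refine (add_pow_le (by positivity) (by positivity) j).trans ?_
    rw [hα]
    calc _ ≤ (2 : ℝ) ^ j * (2 ^ j * (U / t ^ (j + 1))
          + 2 ^ j * ((x ^ (2 * j) + y ^ (2 * j)) / t ^ j)) := by
          gcongr
          · exact le_mul_of_one_le_left (by positivity) (one_le_pow₀ (by norm_num))
          · refine hβ.trans ?_
            rw [mul_div_assoc]
            gcongr
      _ = _ := by
          rw [show (4 : ℝ) = 2 * 2 by norm_num, mul_pow]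
          ring
  -- The choice of `96`: after the factor `4^j` from convexity, the prefactor `2D` turns `1/(24D)`
  -- into the available slack `1/12`.
  have hc : (1 / (96 * D)) ^ j * 4 ^ j ≤ 1 / (24 * D) := by
    rw [← mul_pow, show 1 / (96 * D) * 4 = 1 / (24 * D) by field_simp; norm_num]
    refine pow_le_of_le_one (by positivity) ?_ hj0
    rw [div_le_one (by positivity)]
    linarith
  calc _ = D * t ^ j * (2 * t) * ((1 / (96 * D)) ^ j *
        (U ^ (1 / (j : ℝ)) / t ^ (1 + 1 / (j : ℝ)) + (x ^ 2 + y ^ 2) / t) ^ j) := by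
        rw [mul_pow]; ring
    _ ≤ D * t ^ j * (2 * t) * ((1 / (96 * D)) ^ j *
        (4 ^ j * (U / t ^ (j + 1) + (x ^ (2 * j) + y ^ (2 * j)) / t ^ j))) := by gcongr
    _ = D * t ^ j * (2 * t) * (((1 / (96 * D)) ^ j * 4 ^ j) *
        (U / t ^ (j + 1) + (x ^ (2 * j) + y ^ (2 * j)) / t ^ j)) := by ring
    _ ≤ D * t ^ j * (2 * t) * (1 / (24 * D) *
        (U / t ^ (j + 1) + (x ^ (2 * j) + y ^ (2 * j)) / t ^ j)) := by gcongr
    _ = 1 / 12 * U + 1 / 12 * (x ^ (2 * j) + y ^ (2 * j)) * t := by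
        field_simp
        ring
    _ ≤ _ := by linarith

/-! ### Joint tail estimate and conclusion -/

/-- Joint decay, in the deviation and in the endpoints, of the tail of the bridge functional. -/
lemma exists_bridgeFunctional_tail_le (n j : ℕ) (hn : 1 ≤ n) (hj : 1 ≤ j) :
    ∃ C : ℝ, 1 ≤ C ∧
      ∀ (Ω : Type*) [MeasurableSpace Ω] (P : Measure Ω) [IsProbabilityMeasure P]
        (t : ℝ) (_ : 0 < t)
        (W : ℝ → Ω → EuclideanSpace ℝ (Fin n)) (_ : IsBrownianBridge t W P)
        (x ξ : EuclideanSpace ℝ (Fin n) × ℝ) (_ : 0 < deviation (2 * j) t x ξ),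
        P.real {ω | bridgeFunctional (2 * j) t x.1 ξ.1 W ω > ξ.2 - x.2} ≤
          C * Real.exp (-(C⁻¹ * (deviation (2 * j) t x ξ ^ (1 / (j : ℝ)) / t ^ (1 + 1 / (j : ℝ))
            + (‖x.1‖ ^ 2 + ‖ξ.1‖ ^ 2) / t))) := by
  obtain ⟨D, hD1, hD⟩ := exists_add_pow_le_mul_pow_add (2 * j) (by omega)
  have hn0 : (0 : ℝ) < n := by exact_mod_cast hn
  set A : ℝ := √2 * (j.factorial * (2 * n) ^ j) + Real.exp (1 / (2 * n)) with hA
  have hA0 : 0 ≤ A := by positivity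
  -- `A` is the prefactor of the bridge tail and `2n · 96D` the inverse of its rate in `ρ`.
  set C : ℝ := max 1 (max A (2 * n * (96 * D))) with hC
  have hC1 : 1 ≤ C := le_max_left _ _
  have hCA : A ≤ C := (le_max_left _ _).trans (le_max_right _ _)
  have hCD : 2 * n * (96 * D) ≤ C := (le_max_right _ _).trans (le_max_right _ _)
  refine ⟨C, hC1, fun Ω _ P _ t ht W hW x ξ hU => ?_⟩
  set U := deviation (2 * j) t x ξ with hUdef
  set ρ : ℝ := U ^ (1 / (j : ℝ)) / t ^ (1 + 1 / (j : ℝ)) + (‖x.1‖ ^ 2 + ‖ξ.1‖ ^ 2) / t with hρ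
  have hρ0 : 0 ≤ ρ := by positivity
  have hlevel := level_pow_le (x := ‖x.1‖) (y := ‖ξ.1‖) hj ht hU.le hD1
  rw [← hρ] at hlevel
  have hL0 : 0 ≤ 1 / (96 * D) * ρ := by positivity
  have hsub : P.real {ω | bridgeFunctional (2 * j) t x.1 ξ.1 W ω > ξ.2 - x.2} ≤
      P.real {ω | 2 * t * (1 / (96 * D) * ρ) ^ j < ∫ u in (0 : ℝ)..t, (‖W u ω‖ ^ 2 / t) ^ j} := by
    refine ENNReal.toReal_mono (measure_ne_top _ _) (measure_mono_ae ?_)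
    filter_upwards [hW.continuous_paths] with ω hω h
    change ξ.2 - x.2 < _ at h
    change _ < _
    have hle := bridgeFunctional_le ht hD x.1 ξ.1 hω
    have hslack := two_thirds_le_two_pow_div (k := 2 * j) (by omega)
    have hSt : 0 ≤ (‖x.1‖ ^ (2 * j) + ‖ξ.1‖ ^ (2 * j)) * t := by positivity
    have hmul := mul_le_mul_of_nonneg_right hslack hSt
    have hUeq : ξ.2 - x.2 = U + (2 : ℝ) ^ (2 * j - 1) / (((2 * j : ℕ) : ℝ) + 1) *
        ((‖x.1‖ ^ (2 * j) + ‖ξ.1‖ ^ (2 * j)) * t) := by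
      rw [hUdef, deviation]; ring
    -- The constants close since `2/3 = 7/12 + 1/12`.
    refine lt_of_mul_lt_mul_left (a := D * t ^ j) ?_ (by positivity)
    linarith
  calc _ ≤ _ := hsub
    _ ≤ A * Real.exp (-(1 / (96 * D) * ρ / (2 * n))) :=
        hW.measure_integral_normSq_pow_le hn ht j hL0
    _ ≤ C * Real.exp (-(C⁻¹ * ρ)) := by
        have hcoef : C⁻¹ * ρ ≤ 1 / (96 * D) * ρ / (2 * n) := by
          calc C⁻¹ * ρ ≤ (2 * n * (96 * D))⁻¹ * ρ := by gcongr
            _ = _ := by field_simp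
        gcongr

theorem mainTheorem10 (n k : ℕ) (hn : 1 ≤ n) (hk : 0 < k) (hk_even : Even k) :
    ∃ C : ℝ, 1 ≤ C ∧
      ∀ (Ω : Type*) [MeasurableSpace Ω] (P : Measure Ω) [IsProbabilityMeasure P]
        (t : ℝ) (_ : 0 < t)
        (W : ℝ → Ω → EuclideanSpace ℝ (Fin n)) (_ : IsBrownianBridge t W P)
        (x ξ : EuclideanSpace ℝ (Fin n) × ℝ) (_ : 0 < deviation k t x ξ)
        (K : ℝ) (_ : 0 < K),
        (K * √t ≤ max ‖x.1‖ ‖ξ.1‖ →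
          P.real {ω | bridgeFunctional k t x.1 ξ.1 W ω > ξ.2 - x.2} ≤
            C * (Real.exp (-(C⁻¹ * (deviation k t x ξ ^ 2 /
                    ((‖x.1‖ ^ (k - 1) + ‖ξ.1‖ ^ (k - 1)) ^ 2 * t ^ 3))))
              + Real.exp (-(C⁻¹ * ((‖x.1‖ ^ 2 + ‖ξ.1‖ ^ 2) / t))) *
                ∑ i ∈ Finset.Icc 1 (k / 2),
                  Real.exp (-(C⁻¹ * (deviation k t x ξ ^ (1 / (i : ℝ)) /
                    ((‖x.1‖ ^ (k - 2 * i) + ‖ξ.1‖ ^ (k - 2 * i)) ^ (1 / (i : ℝ)) *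
                      t ^ (1 + 1 / (i : ℝ)))))))) ∧
        (max ‖x.1‖ ‖ξ.1‖ ≤ K * √t →
          P.real {ω | bridgeFunctional k t x.1 ξ.1 W ω > ξ.2 - x.2} ≤
            C * (Real.exp (-(C⁻¹ * (deviation k t x ξ ^ 2 / t ^ (k + 2))))
              + ∑ i ∈ Finset.Icc 1 (k / 2),
                  Real.exp (-(C⁻¹ * (deviation k t x ξ ^ (1 / (i : ℝ)) /
                    t ^ ((k : ℝ) / (2 * (i : ℝ)) + 1 / (i : ℝ))))))) := by
  obtain ⟨j, hkj⟩ := hk_even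
  obtain rfl : k = 2 * j := by omega
  have hj : 1 ≤ j := by omega
  have hjR : (0 : ℝ) < j := by exact_mod_cast hj
  have hmem : j ∈ Finset.Icc 1 (2 * j / 2) := by simp; omega
  obtain ⟨C, hC1, hC⟩ := exists_bridgeFunctional_tail_le n j hn hj
  have hC0 : 0 < C := by linarith
  refine ⟨C, hC1, fun Ω _ P _ t ht W hW x ξ hU K _ => ?_⟩
  have htail := hC Ω P t ht W hW x ξ hU
  set U := deviation (2 * j) t x ξ
  refine ⟨fun _ => htail.trans ?_, fun _ => htail.trans ?_⟩
  · refine mul_le_mul_of_nonneg_left ?_ hC0.le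
    refine le_trans ?_ (le_add_of_nonneg_left (Real.exp_pos _).le)
    rw [mul_add, neg_add, Real.exp_add, mul_comm]
    refine mul_le_mul_of_nonneg_left ?_ (Real.exp_pos _).le
    refine le_trans ?_ (Finset.single_le_sum (f := fun i : ℕ =>
      Real.exp (-(C⁻¹ * (U ^ (1 / (i : ℝ)) /
        ((‖x.1‖ ^ (2 * j - 2 * i) + ‖ξ.1‖ ^ (2 * j - 2 * i)) ^ (1 / (i : ℝ)) *
          t ^ (1 + 1 / (i : ℝ))))))) (fun _ _ => (Real.exp_pos _).le) hmem)
    -- At `i = j` the endpoint sum is `1 + 1`, also when an endpoint vanishes; its `1/j`-th power is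
    -- at least `1`, which only weakens the target.
    simp only [Nat.sub_self, pow_zero]
    rw [Real.exp_le_exp, neg_le_neg_iff]
    gcongr
    exact le_mul_of_one_le_left (by positivity) (Real.one_le_rpow (by norm_num) (by positivity))
  · refine mul_le_mul_of_nonneg_left ?_ hC0.le
    refine le_trans ?_ (le_add_of_nonneg_left (Real.exp_pos _).le)
    refine le_trans ?_ (Finset.single_le_sum (f := fun i : ℕ =>
      Real.exp (-(C⁻¹ * (U ^ (1 / (i : ℝ)) /
        t ^ (((2 * j : ℕ) : ℝ) / (2 * (i : ℝ)) + 1 / (i : ℝ))))))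
      (fun _ _ => (Real.exp_pos _).le) hmem)
    -- At `i = j` the exponent of `t` becomes `1 + 1/j`, so it suffices to discard the endpoint
    -- decay.
    have hexp : ((2 * j : ℕ) : ℝ) / (2 * (j : ℝ)) = 1 := by
      push_cast
      exact div_self (by positivity)
    simp only [hexp]
    rw [Real.exp_le_exp, neg_le_neg_iff]
    gcongr
    exact le_add_of_nonneg_right (by positivity)
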